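/- Let $G$ be a (finite-dimensional, real) Lie group with identity $e$, let $M$ be a finite-dimensional smooth Hausdorff manifold without boundary, and let $\Phi : G\times M\to M$ be a smooth left action which is effective: $\Phi_g=\mathrm{id}_M$ only for $g=e$, where $\Phi_g=\Phi(g,\cdot)$. A flow on a manifold $N$ is a smooth map $\psi:\mathbb R\times N\to N$ with $\psi_0=\mathrm{id}_N$ and $\psi_{s+t}=\psi_s\circ\psi_t$ for all $s,t\in\mathbb R$. A smooth vector field $X$ on $N$ is complete if there is a flow $\psi^X$ on $N$ with $\frac{d}{dt}\psi^X_t(p)=X(\psi^X_t(p))$ for all $t\in\mathbb R$, $p\in N$; this flow is then unique and is called the flow of $X$. A map $f:M\to M$ is weakly $\Phi$-invariant with respect to a map $\sigma:G\to G$ if $f=\Phi_{\sigma(g)^{-1}}\circ f\circ\Phi_g$ for all $g\in G$. A flow $\psi$ on $M$ is weakly $\Phi$-invariant with respect to a flow $\sigma$ on $G$ if, for every $t\in\mathbb R$, $\psi_t$ is weakly $\Phi$-invariant with respect to $\sigma_t$. A smooth vector field $V$ on $M$ is weakly $\Phi$-invariant with respect to a smooth vector field $W$ on $G$ if $\mathrm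 d\Phi\big(W(g),V(p)\big)=V(\Phi(g,p))$ for all $g\in G$, $p\in M$. Theorem. Let $V$ be a complete smooth vector field on $M$ with flow $\psi^V$, and let $W$ be a smooth vector field on $G$. Then $V$ is weakly $\Phi$-invariant with respect to $W$ if and only if $W$ is complete and $\psi^V$ is weakly $\Phi$-invariant with respect to the flow $\psi^W$ of $W$. In that case, for every $t\in\mathbb R$, $\psi^W_t$ is an automorphism of the Lie group $G$ (a homomorphism and a diffeomorphism), and it is the only map $\sigma:G\to G$ with respect to which $\psi^V_t$ is weakly $\Phi$-invariant. -/

import Mathlib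

open scoped Manifold ContDiff

section WeakInvariance

variable {E : Type*} [NormedAddCommGroup E] [NormedSpace ℝ E]
  {H : Type*} [TopologicalSpace H] (I : ModelWithCorners ℝ E H)
  (M : Type*) [TopologicalSpace M] [ChartedSpace H M]

/-- A flow on `M`: a smooth action of `(ℝ, +)` on `M`. -/
structure SmoothFlow where
  /-- The time-`t` map of the flow is `toFun t`. -/
  toFun : ℝ → M → M
  smooth : ContMDiff (𝓘(ℝ, ℝ).prod I) I ∞ (fun x : ℝ × M => toFun x.1 x.2)
  map_add : ∀ (t₁ t₂ : ℝ) (p : M), toFun (t₁ + t₂) p = toFun t₁ (toFun t₂ p)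
  map_zero : ∀ p : M, toFun 0 p = p

instance : CoeFun (SmoothFlow I M) (fun _ => ℝ → M → M) := ⟨SmoothFlow.toFun⟩

variable {M}

/-- `V` is a smooth (`C^∞`) vector field on `M`, as a section of the tangent bundle. -/
def IsSmoothVectorField [IsManifold I 1 M] (V : (p : M) → TangentSpace I p) : Prop :=
  ContMDiff I I.tangent ∞ (fun p => (⟨p, V p⟩ : TangentBundle I M))

variable {I} in
/-- `ψ` is the flow of `V`: `d/dt ψ_t(p) = V(ψ_t(p))` for all `t` and `p`. A vector field is
complete when it has such a flow. -/
def SmoothFlow.IsFlowOf (ψ : SmoothFlow I M) (V : (p : M) → TangentSpace I p) : Prop :=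
  ∀ p : M, IsMIntegralCurve (I := I) (fun t => ψ t p) V

/-- `σ : M → M` is an automorphism of the Lie group `M`: a homomorphism that is also a
diffeomorphism. -/
def IsLieGroupAutomorphism [Group M] (σ : M → M) : Prop :=
  (∀ g h : M, σ (g * h) = σ g * σ h) ∧ ∃ D : M ≃ₘ^∞⟮I, I⟯ M, ⇑D = σ

end WeakInvariance

section WeakInvarianceAction

variable {EG : Type*} [NormedAddCommGroup EG] [NormedSpace ℝ EG]
  {HG : Type*} [TopologicalSpace HG] {IG : ModelWithCorners ℝ EG HG}
  {G : Type*} [TopologicalSpace G] [ChartedSpace HG G] [Group G]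
  {EM : Type*} [NormedAddCommGroup EM] [NormedSpace ℝ EM]
  {HM : Type*} [TopologicalSpace HM] {IM : ModelWithCorners ℝ EM HM}
  {M : Type*} [TopologicalSpace M] [ChartedSpace HM M] [MulAction G M]

/-- The map `f : M → M` is weakly invariant with respect to `σ : G → G`:
`f = Φ_{σ(g)⁻¹} ∘ f ∘ Φ_g` for all `g`, where `Φ_g(p) = g • p`. -/
def IsWeaklyInvariantMap (f : M → M) (σ : G → G) : Prop :=
  ∀ g : G, f = (fun p : M => (σ g)⁻¹ • p) ∘ f ∘ (fun p : M => g • p)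

/-- The flow `ψ` on `M` is weakly invariant with respect to the flow `σ` on `G`: for each `t`, the
map `ψ_t` is weakly invariant with respect to `σ_t`. -/
def IsWeaklyInvariantFlow (ψ : SmoothFlow IM M) (σ : SmoothFlow IG G) : Prop :=
  ∀ t : ℝ, IsWeaklyInvariantMap (ψ t) (σ t)

/-- The vector field `V` on `M` is weakly invariant with respect to the vector field `W` on `G`:
`dΦ(W(g), V(p)) = V(Φ(g, p))` for all `g` and `p`, where `Φ(g, p) = g • p`. -/
def IsWeaklyInvariantVectorField (V : (p : M) → TangentSpace IM p)
    (W : (g : G) → TangentSpace IG g) : Prop :=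
  ∀ (g : G) (p : M),
    mfderiv (IG.prod IM) IM (fun x : G × M => x.1 • x.2) (g, p)
      ((W g, V p) : TangentSpace IG g × TangentSpace IM p) = V (g • p)

end WeakInvarianceAction

open Set Filter Topology Metric

section IntegralCurves

variable {E : Type*} [NormedAddCommGroup E] [NormedSpace ℝ E]
  {H : Type*} [TopologicalSpace H] {I : ModelWithCorners ℝ E H}
  {M : Type*} [TopologicalSpace M] [ChartedSpace H M] [IsManifold I 1 M]
  {v : (x : M) → TangentSpace I x}

/-- Local flows of a `C^1` vector field: uniform existence time and joint continuity. -/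
theorem exists_local_flow_of_contMDiffAt [CompleteSpace E] [BoundarylessManifold I M] {x₀ : M}
    (hv : ContMDiffAt I I.tangent 1 (fun x => (⟨x, v x⟩ : TangentBundle I M)) x₀) :
    ∃ U ∈ 𝓝 x₀, ∃ ε > 0, ∃ γ : M → ℝ → M,
      (∀ x ∈ U, γ x 0 = x ∧ IsMIntegralCurveOn (γ x) v (Ioo (-ε) ε)) ∧
      ContinuousOn (fun y : M × ℝ => γ y.1 y.2) (U ×ˢ Ioo (-ε) ε) := by
  rw [contMDiffAt_iff] at hv
  obtain ⟨_, hv⟩ := hv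
  have hx : I.IsInteriorPoint x₀ := BoundarylessManifold.isInteriorPoint
  obtain ⟨ε₀, hε₀, a, r, L, K, hr, hpl⟩ := IsPicardLindelof.of_contDiffAt_one
    (hv.contDiffAt (range_mem_nhds_isInteriorPoint hx)).snd
  obtain ⟨f, hf1, hf2⟩ :=
    (hpl 0).exists_forall_mem_closedBall_eq_hasDerivWithinAt_continuousOn
  simp only [zero_sub, zero_add] at hf1 hf2
  set c₀ := extChartAt I x₀ x₀
  have hT : (extChartAt I x₀).target ∈ 𝓝 c₀ := by
    exact mem_interior_iff_mem_nhds.mp ((I.isInteriorPoint_iff).mp hx)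
  have hr' : (0 : ℝ) < r := hr
  have hc : ContinuousAt f (c₀, 0) :=
    hf2.continuousAt (prod_mem_nhds (closedBall_mem_nhds _ hr')
      (Icc_mem_nhds (by linarith) (by linarith)))
  have hf0 : f (c₀, 0) = c₀ := (hf1 c₀ (mem_closedBall_self hr'.le)).1
  have hpre : f ⁻¹' interior (extChartAt I x₀).target ∈ 𝓝 (c₀, (0 : ℝ)) :=
    hc (by rw [hf0]; exact interior_mem_nhds.mpr hT)
  obtain ⟨A, hA, B, hB, hAB⟩ := mem_nhds_prod_iff.mp hpre
  obtain ⟨ε₁, hε₁, hB'⟩ := Metric.mem_nhds_iff.mp hB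
  rw [Real.ball_eq_Ioo, zero_sub, zero_add] at hB'
  set ε := min ε₀ ε₁ with hε
  have hεpos : 0 < ε := lt_min hε₀ hε₁
  set U := (extChartAt I x₀).source ∩ (extChartAt I x₀) ⁻¹' (A ∩ closedBall c₀ r)
  have hU : U ∈ 𝓝 x₀ := inter_mem (extChartAt_source_mem_nhds x₀)
    ((continuousAt_extChartAt x₀).preimage_mem_nhds
      (inter_mem hA (closedBall_mem_nhds _ hr')))
  have hmem : ∀ x ∈ U, ∀ t ∈ Ioo (-ε) ε,
      f (extChartAt I x₀ x, t) ∈ interior (extChartAt I x₀).target := fun x hx t ht =>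
    hAB (mk_mem_prod hx.2.1 (hB' ⟨(neg_le_neg (min_le_right _ _)).trans_lt ht.1,
      ht.2.trans_le (min_le_right _ _)⟩))
  have hIcc : ∀ t ∈ Ioo (-ε) ε, t ∈ Ioo (-ε₀) ε₀ := fun t ht =>
    ⟨(neg_le_neg (min_le_left _ _)).trans_lt ht.1, ht.2.trans_le (min_le_left _ _)⟩
  refine ⟨U, hU, ε, hεpos, fun x t => (extChartAt I x₀).symm (f (extChartAt I x₀ x, t)),
    fun x hxU => ⟨?_, fun t ht => ?_⟩, ?_⟩
  · beta_reduce
    rw [(hf1 _ hxU.2.2).1, (extChartAt I x₀).left_inv hxU.1]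
  · let xₜ : M := (extChartAt I x₀).symm (f (extChartAt I x₀ x, t))
    have h : HasDerivAt (fun t => f (extChartAt I x₀ x, t)) (x := t) <|
        fderivWithin ℝ (extChartAt I x₀ ∘ (extChartAt I xₜ).symm)
        (range I) (extChartAt I xₜ xₜ) (v xₜ) :=
      ((hf1 _ hxU.2.2).2 t (Ioo_subset_Icc_self (hIcc t ht))).hasDerivAt
        (Icc_mem_nhds (hIcc t ht).1 (hIcc t ht).2)
    rw [← tangentCoordChange_def] at h
    obtain ⟨u, hu⟩ : ∃ u : E, u = v xₜ := ⟨_, rfl⟩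
    replace h : HasDerivAt (fun t => f (extChartAt I x₀ x, t)) (tangentCoordChange I xₜ x₀ xₜ u) t := by
      rw [hu]; exact h
    have hf3 := hmem x hxU t ht
    have hf3' := interior_subset hf3
    have hft1 := mem_preimage.mp <|
      mem_of_mem_of_subset hf3' (extChartAt I x₀).target_subset_preimage_source
    have hft2 := mem_extChartAt_source (I := I) xₜ
    apply HasMFDerivAt.hasMFDerivWithinAt
    have key : HasDerivAt ((extChartAt I xₜ ∘ (extChartAt I x₀).symm) ∘
        (fun t => f (extChartAt I x₀ x, t))) u t := by
      rw [← tangentCoordChange_self (I := I) (x := xₜ) (z := xₜ) (v := u) hft2,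
        ← tangentCoordChange_comp (x := x₀) ⟨⟨hft2, hft1⟩, hft2⟩]
      apply HasFDerivAt.comp_hasDerivAt _ _ h
      apply HasFDerivWithinAt.hasFDerivAt (s := range I) _ <|
        mem_nhds_iff.mpr ⟨interior (extChartAt I x₀).target,
          subset_trans interior_subset (extChartAt_target_subset_range ..),
          isOpen_interior, hf3⟩
      rw [← (extChartAt I x₀).right_inv hf3']
      exact hasFDerivWithinAt_tangentCoordChange ⟨hft1, hft2⟩
    refine ⟨ContinuousAt.comp (f := fun t => f (extChartAt I x₀ x, t))
      (continuousAt_extChartAt_symm'' hf3') h.continuousAt, ?_⟩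
    have key' : HasFDerivWithinAt (writtenInExtChartAt 𝓘(ℝ, ℝ) I t
        fun t => (extChartAt I x₀).symm (f (extChartAt I x₀ x, t)))
        ((1 : ℝ →L[ℝ] ℝ).smulRight u) (range 𝓘(ℝ, ℝ)) (extChartAt 𝓘(ℝ, ℝ) t t) := by
      rw [ContinuousLinearMap.smulRight_one_eq_toSpanSingleton]
      simp only [mfld_simps]
      exact key.hasFDerivAt.hasFDerivWithinAt
    rw [hu] at key'
    exact key'
  · refine (continuousOn_extChartAt_symm x₀).comp (hf2.comp (ContinuousOn.prodMk
      ((continuousOn_extChartAt x₀).comp continuousOn_fst fun y hy => hy.1.1)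
      continuousOn_snd) fun y hy => ?_) fun y hy => interior_subset (hmem _ hy.1 _ hy.2)
    exact ⟨hy.1.2.2, Ioo_subset_Icc_self (hIcc _ hy.2)⟩

/-- A uniform existence time on a clopen set gives global integral curves from its points. -/
theorem exists_isMIntegralCurve_of_isClopen [BoundarylessManifold I M] [T2Space M]
    (hv : ContMDiff I I.tangent 1 (fun x => (⟨x, v x⟩ : TangentBundle I M)))
    {S : Set M} (hS : IsClopen S) {ε : ℝ} (hε : 0 < ε)
    (h : ∀ x ∈ S, ∃ γ : ℝ → M, γ 0 = x ∧ IsMIntegralCurveOn γ v (Ioo (-ε) ε))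
    {x : M} (hx : x ∈ S) : ∃ γ : ℝ → M, γ 0 = x ∧ IsMIntegralCurve γ v := by
  classical
  let w : (x : M) → TangentSpace I x := fun x => if x ∈ S then v x else 0
  have hw : ContMDiff I I.tangent 1 (fun x => (⟨x, w x⟩ : TangentBundle I M)) := by
    intro y
    by_cases hy : y ∈ S
    · refine (hv y).congr_of_eventuallyEq ?_
      filter_upwards [hS.isOpen.mem_nhds hy] with z hz
      simp [w, hz]
    · refine (Bundle.contMDiff_zeroSection ℝ (TangentSpace I : M → Type _) y).congr_of_eventuallyEq ?_
      filter_upwards [hS.compl.isOpen.mem_nhds hy] with z hz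
      have hz' : z ∉ S := hz
      simp [w, hz', Bundle.zeroSection]
  have hmem : ∀ (γ : ℝ → M) (s : Set ℝ), s.OrdConnected → (0 : ℝ) ∈ s → ContinuousOn γ s →
      γ 0 ∈ S → ∀ t ∈ s, γ t ∈ S := fun γ s hs h0 hc h0S t ht =>
    (hs.isPreconnected.image γ hc).subset_isClopen hS ⟨_, mem_image_of_mem _ h0, h0S⟩
      (mem_image_of_mem _ ht)
  have h' : ∀ y : M, ∃ γ : ℝ → M, γ 0 = y ∧ IsMIntegralCurveOn γ w (Ioo (-ε) ε) := by
    intro y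
    by_cases hy : y ∈ S
    · obtain ⟨γ, h0, hγ⟩ := h y hy
      refine ⟨γ, h0, fun t ht => ?_⟩
      have : γ t ∈ S := hmem γ _ ordConnected_Ioo ⟨by linarith, hε⟩ hγ.continuousOn
        (h0 ▸ hy) t ht
      have hwt : w (γ t) = v (γ t) := if_pos this
      rw [hwt]
      exact hγ t ht
    · exact ⟨fun _ => y, rfl, (isMIntegralCurve_const (if_neg hy)).isMIntegralCurveOn _⟩
  obtain ⟨γ, h0, hγ⟩ := exists_isMIntegralCurve_of_isMIntegralCurveOn hw hε h' x
  refine ⟨γ, h0, fun t => ?_⟩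
  have : γ t ∈ S := hmem γ univ ordConnected_univ (mem_univ _) hγ.continuous.continuousOn
    (h0 ▸ hx) t (mem_univ _)
  have hwt : w (γ t) = v (γ t) := if_pos this
  rw [← hwt]
  exact hγ t

end IntegralCurves

theorem ContinuousLinearMap.comp_prod_smulRight_one {E₁ E₂ F : Type*} [NormedAddCommGroup E₁]
    [NormedSpace ℝ E₁] [NormedAddCommGroup E₂] [NormedSpace ℝ E₂] [NormedAddCommGroup F]
    [NormedSpace ℝ F] (L : E₁ × E₂ →L[ℝ] F) (a : E₁) (b : E₂) :
    L ∘L (((1 : ℝ →L[ℝ] ℝ).smulRight a).prod ((1 : ℝ →L[ℝ] ℝ).smulRight b)) =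
      (1 : ℝ →L[ℝ] ℝ).smulRight (L (a, b)) := by
  ext
  simp

theorem ContinuousLinearMap.smulRight_one_injective {E : Type*} [NormedAddCommGroup E]
    [NormedSpace ℝ E] :
    Function.Injective fun a : E => (1 : ℝ →L[ℝ] ℝ).smulRight a := fun a b h => by
  simpa using congrArg (fun L : ℝ →L[ℝ] E => L 1) h

section WeakInvarianceCurves

variable {EG : Type*} [NormedAddCommGroup EG] [NormedSpace ℝ EG]
  {G : Type*} [TopologicalSpace G] [ChartedSpace EG G] [Group G]
  {EM : Type*} [NormedAddCommGroup EM] [NormedSpace ℝ EM]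
  {M : Type*} [TopologicalSpace M] [ChartedSpace EM M] [MulAction G M]
  {V : (p : M) → TangentSpace 𝓘(ℝ, EM) p} {W : (g : G) → TangentSpace 𝓘(ℝ, EG) g}

theorem HasMFDerivAt.smul_curve [ContMDiffSMul 𝓘(ℝ, EG) 𝓘(ℝ, EM) ∞ G M]
    {γ : ℝ → G} {c : ℝ → M} {t : ℝ}
    {a : TangentSpace 𝓘(ℝ, EG) (γ t)} {b : TangentSpace 𝓘(ℝ, EM) (c t)}
    (hγ : HasMFDerivAt 𝓘(ℝ, ℝ) 𝓘(ℝ, EG) γ t ((1 : ℝ →L[ℝ] ℝ).smulRight a))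
    (hc : HasMFDerivAt 𝓘(ℝ, ℝ) 𝓘(ℝ, EM) c t ((1 : ℝ →L[ℝ] ℝ).smulRight b)) :
    HasMFDerivAt 𝓘(ℝ, ℝ) 𝓘(ℝ, EM) (fun s => γ s • c s) t
      ((1 : ℝ →L[ℝ] ℝ).smulRight
        (mfderiv (𝓘(ℝ, EG).prod 𝓘(ℝ, EM)) 𝓘(ℝ, EM) (fun x : G × M => x.1 • x.2) (γ t, c t)
          ((a, b) : TangentSpace 𝓘(ℝ, EG) (γ t) × TangentSpace 𝓘(ℝ, EM) (c t)))) := by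
  have hs : MDifferentiableAt (𝓘(ℝ, EG).prod 𝓘(ℝ, EM)) 𝓘(ℝ, EM)
      (fun x : G × M => x.1 • x.2) (γ t, c t) :=
    (contMDiff_smul (I := 𝓘(ℝ, EG)) (I' := 𝓘(ℝ, EM)) (n := ∞)).mdifferentiable (by simp) _
  have := HasMFDerivAt.comp t hs.hasMFDerivAt (hγ.prodMk hc)
  exact HasMFDerivAt.congr_mfderiv this
    (ContinuousLinearMap.comp_prod_smulRight_one (E₁ := EG) (E₂ := EM) (F := EM) _ _ _)

theorem IsWeaklyInvariantVectorField.hasMFDerivAt_smul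
    [ContMDiffSMul 𝓘(ℝ, EG) 𝓘(ℝ, EM) ∞ G M] (h : IsWeaklyInvariantVectorField V W)
    {γ : ℝ → G} {c : ℝ → M} {t : ℝ}
    (hγ : HasMFDerivAt 𝓘(ℝ, ℝ) 𝓘(ℝ, EG) γ t ((1 : ℝ →L[ℝ] ℝ).smulRight (W (γ t))))
    (hc : HasMFDerivAt 𝓘(ℝ, ℝ) 𝓘(ℝ, EM) c t ((1 : ℝ →L[ℝ] ℝ).smulRight (V (c t)))) :
    HasMFDerivAt 𝓘(ℝ, ℝ) 𝓘(ℝ, EM) (fun s => γ s • c s) t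
      ((1 : ℝ →L[ℝ] ℝ).smulRight (V (γ t • c t))) := by
  have := hγ.smul_curve hc
  rwa [h (γ t) (c t)] at this

/-- Products of integral curves are integral curves. -/
theorem IsWeaklyInvariantVectorField.isMIntegralCurveOn_smul
    [ContMDiffSMul 𝓘(ℝ, EG) 𝓘(ℝ, EM) ∞ G M] (h : IsWeaklyInvariantVectorField V W)
    {γ : ℝ → G} {c : ℝ → M} {s : Set ℝ} (hs : IsOpen s)
    (hγ : IsMIntegralCurveOn (I := 𝓘(ℝ, EG)) γ W s)
    (hc : IsMIntegralCurveOn (I := 𝓘(ℝ, EM)) c V s) :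
    IsMIntegralCurveOn (I := 𝓘(ℝ, EM)) (fun t => γ t • c t) V s := fun t ht =>
  (h.hasMFDerivAt_smul ((hγ t ht).hasMFDerivAt (hs.mem_nhds ht))
    ((hc t ht).hasMFDerivAt (hs.mem_nhds ht))).hasMFDerivWithinAt

/-- An integral curve of `W` intertwines the flow of `V`. -/
theorem IsWeaklyInvariantVectorField.smul_flow_eq [T2Space M] [IsManifold 𝓘(ℝ, EM) ∞ M]
    [ContMDiffSMul 𝓘(ℝ, EG) 𝓘(ℝ, EM) ∞ G M]
    (h : IsWeaklyInvariantVectorField V W) (hV : IsSmoothVectorField 𝓘(ℝ, EM) V)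
    {ψ : SmoothFlow 𝓘(ℝ, EM) M} (hψ : ψ.IsFlowOf V) {γ : ℝ → G} {a b : ℝ} (h0 : 0 ∈ Ioo a b)
    (hγ : IsMIntegralCurveOn (I := 𝓘(ℝ, EG)) γ W (Ioo a b)) {t : ℝ} (ht : t ∈ Ioo a b) (p : M) :
    γ t • ψ t p = ψ t (γ 0 • p) := by
  refine isMIntegralCurveOn_Ioo_eqOn_of_contMDiff_boundaryless
    (γ := fun t => γ t • ψ t p) (γ' := fun t => ψ t (γ 0 • p)) h0 (hV.of_le (by simp))
    (h.isMIntegralCurveOn_smul isOpen_Ioo hγ ((hψ p).isMIntegralCurveOn _))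
    ((hψ _).isMIntegralCurveOn _) ?_ ht
  simp [ψ.map_zero]

theorem IsWeaklyInvariantVectorField.eq_of_isMIntegralCurveOn [T2Space M] [IsManifold 𝓘(ℝ, EM) ∞ M]
    [ContMDiffSMul 𝓘(ℝ, EG) 𝓘(ℝ, EM) ∞ G M] [FaithfulSMul G M]
    (h : IsWeaklyInvariantVectorField V W) (hV : IsSmoothVectorField 𝓘(ℝ, EM) V)
    {ψ : SmoothFlow 𝓘(ℝ, EM) M} (hψ : ψ.IsFlowOf V) {γ₁ γ₂ γ₃ : ℝ → G} {a b : ℝ}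
    (h0 : 0 ∈ Ioo a b)
    (h₁ : IsMIntegralCurveOn (I := 𝓘(ℝ, EG)) γ₁ W (Ioo a b))
    (h₂ : IsMIntegralCurveOn (I := 𝓘(ℝ, EG)) γ₂ W (Ioo a b))
    (h₃ : IsMIntegralCurveOn (I := 𝓘(ℝ, EG)) γ₃ W (Ioo a b))
    (h_init : γ₃ 0 = γ₁ 0 * γ₂ 0) {t : ℝ} (ht : t ∈ Ioo a b) : γ₃ t = γ₁ t * γ₂ t := by
  refine FaithfulSMul.eq_of_smul_eq_smul (α := M) fun q => ?_
  obtain ⟨p, rfl⟩ : ∃ p, ψ t p = q := ⟨ψ (-t) q, by rw [← ψ.map_add, add_neg_cancel, ψ.map_zero]⟩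
  rw [mul_smul, h.smul_flow_eq hV hψ h0 h₂ ht, h.smul_flow_eq hV hψ h0 h₁ ht,
    h.smul_flow_eq hV hψ h0 h₃ ht, h_init, mul_smul]

/-- `W` is multiplicative: it is weakly invariant with respect to itself for the action of `G` on
itself by left multiplication. -/
theorem IsWeaklyInvariantVectorField.self_mul [T2Space M] [IsManifold 𝓘(ℝ, EM) ∞ M]
    [CompleteSpace EG] [LieGroup 𝓘(ℝ, EG) ∞ G]
    [ContMDiffSMul 𝓘(ℝ, EG) 𝓘(ℝ, EM) ∞ G M] [FaithfulSMul G M]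
    (h : IsWeaklyInvariantVectorField V W) (hV : IsSmoothVectorField 𝓘(ℝ, EM) V)
    {ψ : SmoothFlow 𝓘(ℝ, EM) M} (hψ : ψ.IsFlowOf V) (hW : IsSmoothVectorField 𝓘(ℝ, EG) W) :
    IsWeaklyInvariantVectorField W W := by
  intro g k
  have hex : ∀ x : G, ∃ γ : ℝ → G, γ 0 = x ∧ IsMIntegralCurveAt (I := 𝓘(ℝ, EG)) γ W 0 := fun x =>
    exists_isMIntegralCurveAt_of_contMDiffAt_boundaryless 0 ((hW x).of_le (by simp))
  obtain ⟨γ₁, i₁, h₁⟩ := hex g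
  obtain ⟨γ₂, i₂, h₂⟩ := hex k
  obtain ⟨γ₃, i₃, h₃⟩ := hex (g * k)
  obtain ⟨ε₁, p₁, c₁⟩ := isMIntegralCurveAt_iff'.mp h₁
  obtain ⟨ε₂, p₂, c₂⟩ := isMIntegralCurveAt_iff'.mp h₂
  obtain ⟨ε₃, p₃, c₃⟩ := isMIntegralCurveAt_iff'.mp h₃
  obtain ⟨ε, hε, e₁, e₂, e₃⟩ : ∃ ε > 0, ε ≤ ε₁ ∧ ε ≤ ε₂ ∧ ε ≤ ε₃ :=
    ⟨min ε₁ (min ε₂ ε₃), by positivity, min_le_left _ _,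
      (min_le_right _ _).trans (min_le_left _ _), (min_le_right _ _).trans (min_le_right _ _)⟩
  have hb : Ioo (-ε) ε = ball 0 ε := by rw [Real.ball_eq_Ioo, zero_sub, zero_add]
  have h0 : (0 : ℝ) ∈ Ioo (-ε) ε := ⟨by linarith, hε⟩
  have heq : (fun t => γ₁ t • γ₂ t) =ᶠ[𝓝 0] γ₃ := by
    filter_upwards [Ioo_mem_nhds h0.1 h0.2] with t ht
    refine (h.eq_of_isMIntegralCurveOn hV hψ h0 (c₁.mono ?_) (c₂.mono ?_) (c₃.mono ?_) ?_ ht).symm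
    · exact hb ▸ ball_subset_ball e₁
    · exact hb ▸ ball_subset_ball e₂
    · exact hb ▸ ball_subset_ball e₃
    · rw [i₁, i₂, i₃]
  have hd := h₁.hasMFDerivAt.smul_curve h₂.hasMFDerivAt
  have hd' := h₃.hasMFDerivAt.congr_of_eventuallyEq heq
  have key := ContinuousLinearMap.smulRight_one_injective (E := EG) (hasMFDerivAt_unique hd hd')
  subst i₁ i₂
  rw [smul_eq_mul, ← i₃]
  exact key

end WeakInvarianceCurves

section MultiplicativeVectorFields

variable {EG : Type*} [NormedAddCommGroup EG] [NormedSpace ℝ EG]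
  {G : Type*} [TopologicalSpace G] [ChartedSpace EG G] [Group G]
  {W : (g : G) → TangentSpace 𝓘(ℝ, EG) g}

/-- A multiplicative vector field on a Lie group is complete. -/
theorem IsWeaklyInvariantVectorField.exists_isMIntegralCurve [CompleteSpace EG] [T2Space G]
    [LieGroup 𝓘(ℝ, EG) ∞ G]
    (h : IsWeaklyInvariantVectorField W W) (hW : IsSmoothVectorField 𝓘(ℝ, EG) W) (g : G) :
    ∃ γ : ℝ → G, γ 0 = g ∧ IsMIntegralCurve (I := 𝓘(ℝ, EG)) γ W := by
  have hW1 : ContMDiff 𝓘(ℝ, EG) 𝓘(ℝ, EG).tangent 1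
    (fun x => (⟨x, W x⟩ : TangentBundle 𝓘(ℝ, EG) G)) := hW.of_le (by simp)
  have : IsTopologicalGroup G := topologicalGroup_of_lieGroup 𝓘(ℝ, EG) ∞
  obtain ⟨U, hU, ε, hε, γ, hγ, -⟩ := exists_local_flow_of_contMDiffAt (hW1 1)
  obtain ⟨U', hU', δ, hδ, γ', hγ', -⟩ := exists_local_flow_of_contMDiffAt (hW1 g)
  set η := min ε δ
  have hη : 0 < η := lt_min hε hδ
  have hle : Ioo (-η) η ⊆ Ioo (-ε) ε :=
    Ioo_subset_Ioo (neg_le_neg (min_le_left _ _)) (min_le_left _ _)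
  have hle' : Ioo (-η) η ⊆ Ioo (-δ) δ :=
    Ioo_subset_Ioo (neg_le_neg (min_le_right _ _)) (min_le_right _ _)
  let S : Set G := {x | ∃ c : ℝ → G, c 0 = x ∧
    IsMIntegralCurveOn (I := 𝓘(ℝ, EG)) c W (Ioo (-η) η)}
  have hgS : g ∈ S := by
    obtain ⟨h0, hc⟩ := hγ' g (mem_of_mem_nhds hU')
    exact ⟨γ' g, h0, hc.mono hle'⟩
  have hmul : ∀ x ∈ S, ∀ u ∈ U, x * u ∈ S := by
    rintro x ⟨c, rfl, hc⟩ u hu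
    obtain ⟨h0, hu⟩ := hγ u hu
    exact ⟨fun t => c t • γ u t, by simp [h0],
      h.isMIntegralCurveOn_smul isOpen_Ioo hc (hu.mono hle)⟩
  have hS : IsClopen S := by
    refine ⟨isClosed_iff_frequently.mpr fun x hx => ?_, isOpen_iff_mem_nhds.mpr fun x hx => ?_⟩
    · have hn : ∀ᶠ y in 𝓝 x, y⁻¹ * x ∈ U := by
        have : ContinuousAt (fun y : G => y⁻¹ * x) x := by fun_prop
        exact this (by simpa using hU)
      obtain ⟨y, hy, hyU⟩ := (hx.and_eventually hn).exists
      simpa using hmul y hy _ hyU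
    · have hn : ∀ᶠ y in 𝓝 x, x⁻¹ * y ∈ U := by
        have : ContinuousAt (fun y : G => x⁻¹ * y) x := by fun_prop
        exact this (by simpa using hU)
      filter_upwards [hn] with y hy
      simpa using hmul x hx _ hy
  exact exists_isMIntegralCurve_of_isClopen hW1 hS hη (fun x hx => hx) hgS

variable [T2Space G] [LieGroup 𝓘(ℝ, EG) ∞ G] {φ : ℝ → G → G}

theorem flow_add_of_isMIntegralCurve
    (hW : IsSmoothVectorField 𝓘(ℝ, EG) W) (h0 : ∀ g, φ 0 g = g)
    (hφ : ∀ g, IsMIntegralCurve (I := 𝓘(ℝ, EG)) (fun t => φ t g) W) (s t : ℝ) (g : G) :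
    φ (s + t) g = φ s (φ t g) := by
  refine congrFun (isMIntegralCurve_Ioo_eq_of_contMDiff_boundaryless (t₀ := 0)
    (γ := fun s => φ (s + t) g) (γ' := fun s => φ s (φ t g)) (hW.of_le (by simp))
    ((hφ g).comp_add t) (hφ _) ?_) s
  simp [h0]

theorem IsWeaklyInvariantVectorField.flow_mul (h : IsWeaklyInvariantVectorField W W)
    (hW : IsSmoothVectorField 𝓘(ℝ, EG) W) (h0 : ∀ g, φ 0 g = g)
    (hφ : ∀ g, IsMIntegralCurve (I := 𝓘(ℝ, EG)) (fun t => φ t g) W) (t : ℝ) (g k : G) :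
    φ t (g * k) = φ t g * φ t k := by
  refine congrFun (isMIntegralCurve_Ioo_eq_of_contMDiff_boundaryless (t₀ := 0)
    (γ := fun s => φ s (g * k)) (γ' := fun s => φ s g • φ s k) (hW.of_le (by simp))
    (hφ _) (fun t => h.hasMFDerivAt_smul (hφ g t) (hφ k t)) ?_) t
  simp [h0]

theorem IsWeaklyInvariantVectorField.continuous_flow [CompleteSpace EG]
    (h : IsWeaklyInvariantVectorField W W)
    (hW : IsSmoothVectorField 𝓘(ℝ, EG) W) (h0 : ∀ g, φ 0 g = g)
    (hφ : ∀ g, IsMIntegralCurve (I := 𝓘(ℝ, EG)) (fun t => φ t g) W) :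
    Continuous fun x : ℝ × G => φ x.1 x.2 := by
  have : IsTopologicalGroup G := topologicalGroup_of_lieGroup 𝓘(ℝ, EG) ∞
  have hadd := flow_add_of_isMIntegralCurve hW h0 hφ
  have hmul := h.flow_mul hW h0 hφ
  obtain ⟨U, hU, ε, hε, γ, hγ, hc⟩ := exists_local_flow_of_contMDiffAt
    ((hW 1).of_le (show (1 : WithTop ℕ∞) ≤ ∞ by simp))
  have hone : ∀ s ∈ Ioo (-ε) ε, ContinuousAt (fun x : ℝ × G => φ x.1 x.2) (s, 1) := by
    intro s hs
    have hs' : Ioo (-ε) ε ∈ 𝓝 s := Ioo_mem_nhds hs.1 hs.2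
    have h1 : ContinuousAt (fun y : G × ℝ => γ y.1 y.2) (1, s) :=
      hc.continuousAt (prod_mem_nhds hU hs')
    have h2 : ContinuousAt (fun x : ℝ × G => γ x.2 x.1) (s, 1) :=
      ContinuousAt.comp (f := fun x : ℝ × G => (x.2, x.1)) (x := (s, 1)) h1 (by fun_prop)
    refine h2.congr ?_
    filter_upwards [prod_mem_nhds hs' hU] with x hx
    obtain ⟨i, hi⟩ := hγ x.2 hx.2
    exact isMIntegralCurveOn_Ioo_eqOn_of_contMDiff_boundaryless (γ := γ x.2)
      (γ' := fun t => φ t x.2) (t₀ := 0) ⟨by linarith, hε⟩ (hW.of_le (by simp)) hi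
      ((hφ _).isMIntegralCurveOn _) (by simp [i, h0]) hx.1
  have hsmall : ∀ s ∈ Ioo (-ε) ε, ∀ g, ContinuousAt (fun x : ℝ × G => φ x.1 x.2) (s, g) := by
    intro s hs g
    have h1 : ContinuousAt (fun x : ℝ × G => φ x.1 (g⁻¹ * x.2)) (s, g) :=
      ContinuousAt.comp (g := fun x : ℝ × G => φ x.1 x.2)
        (f := fun x : ℝ × G => (x.1, g⁻¹ * x.2)) (x := (s, g))
        (by simpa using hone s hs) (by fun_prop)
    have h2 : ContinuousAt (fun x : ℝ × G => φ x.1 g) (s, g) :=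
      ((hφ g).continuous.comp continuous_fst).continuousAt
    refine (h2.mul h1).congr (Eventually.of_forall fun x => ?_)
    simp [← hmul]
  have hfix : ∀ t, Continuous (φ t) := by
    intro t
    obtain ⟨n, hn⟩ := exists_nat_gt (|t| / ε)
    have hn0 : (0 : ℝ) < n := (by positivity : 0 ≤ |t| / ε).trans_lt hn
    have hs : t / n ∈ Ioo (-ε) ε := by
      rw [mem_Ioo, ← abs_lt, abs_div, abs_of_pos hn0, div_lt_iff₀ hn0]
      rwa [div_lt_iff₀ hε, mul_comm] at hn
    have hcs : Continuous (φ (t / n)) := continuous_iff_continuousAt.mpr fun g =>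
      ContinuousAt.comp (g := fun x : ℝ × G => φ x.1 x.2) (f := fun x : G => (t / n, x))
        (x := g) (hsmall _ hs g) (by fun_prop)
    have hk : ∀ k : ℕ, Continuous (φ (k * (t / n))) := by
      intro k
      induction k with
      | zero => simpa [h0, funext h0] using! continuous_id
      | succ k ih =>
        have : φ ((k + 1 : ℕ) * (t / n)) = φ (k * (t / n)) ∘ φ (t / n) := by
          ext g
          rw [Function.comp_apply, ← hadd]
          congr 1
          push_cast
          ring
        rw [this]
        exact ih.comp hcs
    have := hk n
    rwa [mul_div_cancel₀ _ hn0.ne'] at this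
  refine continuous_iff_continuousAt.mpr fun ⟨t, g⟩ => ?_
  have h1 : ContinuousAt (fun x : ℝ × G => φ (x.1 - t) x.2) (t, g) :=
    ContinuousAt.comp (g := fun x : ℝ × G => φ x.1 x.2) (f := fun x : ℝ × G => (x.1 - t, x.2))
      (x := (t, g)) (hsmall _ (by simp [hε]) _) (by fun_prop)
  refine ((hfix t).continuousAt.comp h1).congr (Eventually.of_forall fun x => ?_)
  simp [← hadd]

end MultiplicativeVectorFields

section SmoothLift

/-- A continuous lift of a smooth map through an immersion is smooth. -/
theorem ContMDiffAt.of_comp_of_injective_mfderiv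
    {E : Type*} [NormedAddCommGroup E] [NormedSpace ℝ E] [FiniteDimensional ℝ E]
    {M : Type*} [TopologicalSpace M] [ChartedSpace E M] [IsManifold 𝓘(ℝ, E) ∞ M]
    {E' : Type*} [NormedAddCommGroup E'] [NormedSpace ℝ E'] {H' : Type*} [TopologicalSpace H']
    {J : ModelWithCorners ℝ E' H'} {N : Type*} [TopologicalSpace N] [ChartedSpace H' N]
    {F : Type*} [NormedAddCommGroup F] [NormedSpace ℝ F] [FiniteDimensional ℝ F]
    {f : N → M} {A : M → F} {x : N} (hf : ContinuousAt f x)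
    (hA : ContMDiffAt 𝓘(ℝ, E) 𝓘(ℝ, F) ∞ A (f x))
    (hinj : Function.Injective (mfderiv 𝓘(ℝ, E) 𝓘(ℝ, F) A (f x)))
    (hAf : ContMDiffAt J 𝓘(ℝ, F) ∞ (fun y => A (f y)) x) : ContMDiffAt J 𝓘(ℝ, E) ∞ f x := by
  have : CompleteSpace E := FiniteDimensional.complete ℝ E
  set e := extChartAt 𝓘(ℝ, E) (f x)
  have hB : ContDiffAt ℝ ∞ (A ∘ e.symm) (e (f x)) := by
    have := (contMDiffAt_iff.mp hA).2
    simpa [contDiffWithinAt_univ] using! this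
  let D : E →L[ℝ] F := mfderiv 𝓘(ℝ, E) 𝓘(ℝ, F) A (f x)
  have hD : HasFDerivAt (A ∘ e.symm) D (e (f x)) := by
    have : HasFDerivWithinAt (A ∘ e.symm) D (range 𝓘(ℝ, E)) (e (f x)) :=
      (hA.mdifferentiableAt (by simp)).hasMFDerivAt.2
    rwa [ModelWithCorners.range_eq_univ, hasFDerivWithinAt_univ] at this
  obtain ⟨L₀, hL₀⟩ := D.toLinearMap.exists_leftInverse_of_injective (LinearMap.ker_eq_bot.mpr hinj)
  let L : F →L[ℝ] E := L₀.toContinuousLinearMap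
  have hLD : L ∘L D = (ContinuousLinearEquiv.refl ℝ E : E →L[ℝ] E) := by
    ext v
    exact congrArg (fun T : E →ₗ[ℝ] E => T v) hL₀
  let K : E → E := L ∘ (A ∘ e.symm)
  have hK : ContDiffAt ℝ ∞ K (e (f x)) := L.contDiff.contDiffAt.comp _ hB
  have hK' : HasFDerivAt K ((ContinuousLinearEquiv.refl ℝ E : E ≃L[ℝ] E) : E →L[ℝ] E)
      (e (f x)) := by
    rw [← hLD]
    exact L.hasFDerivAt.comp _ hD
  have hne : (∞ : WithTop ℕ∞) ≠ 0 := by simp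
  have hinv := hK.to_localInverse hK' hne
  refine contMDiffAt_iff_target.mpr ⟨hf, ?_⟩
  have hcomp : ContMDiffAt J 𝓘(ℝ, E) ∞
      (fun y => hK.localInverse hK' hne (L (A (f y)))) x := by
    have h1 : ContMDiffAt J 𝓘(ℝ, E) ∞ (fun y => L (A (f y))) x :=
      ContMDiffAt.comp (g := L) x L.contDiff.contMDiff.contMDiffAt hAf
    have h2 : ContMDiffAt 𝓘(ℝ, E) 𝓘(ℝ, E) ∞ (hK.localInverse hK' hne) (L (A (f x))) := by
      have : K (e (f x)) = L (A (f x)) := by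
        simp [K, e]
      rw [← this]
      exact hinv.contMDiffAt
    exact ContMDiffAt.comp (g := hK.localInverse hK' hne) (f := fun y => L (A (f y))) x h2 h1
  refine hcomp.congr_of_eventuallyEq ?_
  have hsrc : ∀ᶠ y in 𝓝 x, f y ∈ e.source := hf (extChartAt_source_mem_nhds (I := 𝓘(ℝ, E)) (f x))
  have hce : ContinuousAt (fun y => e (f y)) x :=
    ContinuousAt.comp (g := e) (continuousAt_extChartAt (I := 𝓘(ℝ, E)) (f x)) hf
  have hS : ∀ᶠ y in 𝓝 x, e (f y) ∈ (hK.toOpenPartialHomeomorph K hK' hne).source :=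
    hce ((hK.toOpenPartialHomeomorph K hK' hne).open_source.mem_nhds
      (hK.mem_toOpenPartialHomeomorph_source hK' hne))
  filter_upwards [hsrc, hS] with y hy hyS
  have h1 := (hK.toOpenPartialHomeomorph K hK' hne).left_inv hyS
  have h2 : K (e (f y)) = L (A (f y)) := by
    simp [K, e.left_inv hy]
  rw [ContDiffAt.toOpenPartialHomeomorph_coe, h2] at h1
  exact h1.symm

/-- A family of linear maps with trivial common kernel on a finite-dimensional space has a finite
subfamily with trivial common kernel. -/
theorem exists_finset_forall_eq_zero_of_forall_eq_zero {E F ι : Type*} [NormedAddCommGroup E]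
    [NormedSpace ℝ E] [FiniteDimensional ℝ E] [NormedAddCommGroup F] [NormedSpace ℝ F]
    (A : ι → E →L[ℝ] F) (hA : ∀ v, (∀ i, A i v = 0) → v = 0) :
    ∃ s : Finset ι, ∀ v, (∀ i ∈ s, A i v = 0) → v = 0 := by
  classical
  let K : Finset ι → Submodule ℝ E := fun s => ⨅ i ∈ s, LinearMap.ker (A i).toLinearMap
  have hK : ∀ s v, v ∈ K s ↔ ∀ i ∈ s, A i v = 0 := fun s v => by simp [K]
  obtain ⟨_, ⟨s, rfl⟩, hs⟩ :=
    (wellFounded_lt (α := Submodule ℝ E)).has_min (range K) (range_nonempty K)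
  refine ⟨s, fun v hv => hA v fun i => ?_⟩
  by_contra hi
  refine hs (K (insert i s)) (mem_range_self _) (SetLike.lt_iff_le_and_exists.mpr
    ⟨fun w hw => (hK s w).mpr fun j hj => (hK _ w).mp hw j (Finset.mem_insert_of_mem hj),
      v, (hK s v).mpr hv, fun hv' => hi ((hK _ v).mp hv' i (Finset.mem_insert_self i s))⟩)

end SmoothLift

section InfinitesimalFaithfulness

variable {EG : Type*} [NormedAddCommGroup EG] [NormedSpace ℝ EG]
  {EM : Type*} [NormedAddCommGroup EM] [NormedSpace ℝ EM]
  {G : Type*} [TopologicalSpace G] [ChartedSpace EG G] [Group G]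
  {M : Type*} [TopologicalSpace M] [ChartedSpace EM M]
  [MulAction G M] [ContMDiffSMul 𝓘(ℝ, EG) 𝓘(ℝ, EM) ∞ G M]

theorem contMDiff_smul_const (p : M) :
    ContMDiff 𝓘(ℝ, EG) 𝓘(ℝ, EM) ∞ fun g : G => g • p :=
  ContMDiff.smul (I := 𝓘(ℝ, EG)) contMDiff_id contMDiff_const

theorem hasMFDerivAt_smul_const (p : M) (g : G) :
    HasMFDerivAt 𝓘(ℝ, EG) 𝓘(ℝ, EM) (fun x : G => x • p) g
      (mfderiv 𝓘(ℝ, EG) 𝓘(ℝ, EM) (fun x : G => x • p) g) :=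
  ((contMDiff_smul_const p).mdifferentiable (by simp) g).hasMFDerivAt

variable [LieGroup 𝓘(ℝ, EG) ∞ G]

/-- A left-invariant vector field whose value at `1` is killed by the derivative of an orbit map is
killed by it everywhere. -/
theorem mfderiv_smul_const_mulInvariantVectorField (g : G) (p : M)
    (X : GroupLieAlgebra 𝓘(ℝ, EG) G)
    (hX : mfderiv 𝓘(ℝ, EG) 𝓘(ℝ, EM) (fun x : G => x • p) 1 X = 0) :
    mfderiv 𝓘(ℝ, EG) 𝓘(ℝ, EM) (fun x : G => x • p) g (mulInvariantVectorField X g) = 0 := by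
  have h1 : HasMFDerivAt 𝓘(ℝ, EG) 𝓘(ℝ, EM) (fun x : G => (g * x) • p) 1
      ((mfderiv 𝓘(ℝ, EG) 𝓘(ℝ, EM) (fun x : G => x • p) (g * 1)) ∘L
        (mfderiv 𝓘(ℝ, EG) 𝓘(ℝ, EG) (fun x : G => g * x) 1)) :=
    HasMFDerivAt.comp (1 : G) (hasMFDerivAt_smul_const p (g * 1))
      ((contMDiff_mul_left (I := 𝓘(ℝ, EG)) (n := ∞)).mdifferentiable (by simp) 1).hasMFDerivAt
  have h2 : HasMFDerivAt 𝓘(ℝ, EG) 𝓘(ℝ, EM) (fun x : G => g • x • p) 1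
      ((mfderiv 𝓘(ℝ, EM) 𝓘(ℝ, EM) (fun q : M => g • q) ((1 : G) • p)) ∘L
        (mfderiv 𝓘(ℝ, EG) 𝓘(ℝ, EM) (fun x : G => x • p) 1)) :=
    HasMFDerivAt.comp (1 : G) (((ContMDiffSMul.contMDiff_const_smul (I := 𝓘(ℝ, EG))
      (I' := 𝓘(ℝ, EM)) (n := ∞) g).mdifferentiable (by simp) _).hasMFDerivAt)
      (hasMFDerivAt_smul_const p 1)
  have key := congrArg (fun L : EG →L[ℝ] EM => L X) (hasMFDerivAt_unique
    (h1.congr_of_eventuallyEq (Eventually.of_forall fun x => (mul_smul g x p).symm)) h2)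
  have key' : ∀ y : G, y = g * 1 → (mfderiv 𝓘(ℝ, EG) 𝓘(ℝ, EM) (fun x : G => x • p) y :
      EG →L[ℝ] EM) (mfderiv 𝓘(ℝ, EG) 𝓘(ℝ, EG) (fun x : G => g * x) 1 X : EG) = 0 := by
    rintro _ rfl
    refine key.trans ?_
    exact (congrArg (mfderiv 𝓘(ℝ, EM) 𝓘(ℝ, EM) (fun q : M => g • q) ((1 : G) • p)) hX).trans
      (map_zero _)
  exact key' g (mul_one g).symm

variable [T2Space M] [IsManifold 𝓘(ℝ, EM) ∞ M]

/-- A smooth faithful action is infinitesimally faithful. -/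
theorem eq_zero_of_mfderiv_smul_one_eq_zero [CompleteSpace EG] [FaithfulSMul G M]
    (X : TangentSpace 𝓘(ℝ, EG) (1 : G))
    (hX : ∀ p : M, mfderiv 𝓘(ℝ, EG) 𝓘(ℝ, EM) (fun x : G => x • p) 1 X = 0) : X = 0 := by
  have : LieGroup 𝓘(ℝ, EG) (minSmoothness ℝ 3) G := by
    rw [minSmoothness_of_isRCLikeNormedField]
    infer_instance
  obtain ⟨c, h0, hc⟩ := exists_isMIntegralCurveAt_of_contMDiffAt_boundaryless
    (I := 𝓘(ℝ, EG)) (x₀ := (1 : G)) 0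
    ((contMDiff_mulInvariantVectorField (I := 𝓘(ℝ, EG)) X (1 : G)).of_le
      (by rw [minSmoothness_of_isRCLikeNormedField]; exact one_le_two))
  obtain ⟨ε, hε, hcε⟩ := isMIntegralCurveAt_iff'.mp hc
  rw [Real.ball_eq_Ioo, zero_sub, zero_add] at hcε
  have hmem : (0 : ℝ) ∈ Ioo (-ε) ε := ⟨by linarith, hε⟩
  have hconst : ∀ t ∈ Ioo (-ε) ε, c t = 1 := by
    intro t ht
    refine FaithfulSMul.eq_of_smul_eq_smul (α := M) fun q => ?_
    rw [one_smul]
    let Z : (p : M) → TangentSpace 𝓘(ℝ, EM) p := fun _ => 0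
    have hZ : ContMDiff 𝓘(ℝ, EM) 𝓘(ℝ, EM).tangent 1
        (fun x => (⟨x, Z x⟩ : TangentBundle 𝓘(ℝ, EM) M)) :=
      Bundle.contMDiff_zeroSection ℝ (TangentSpace 𝓘(ℝ, EM) : M → Type _)
    have hcq : IsMIntegralCurveOn (I := 𝓘(ℝ, EM)) (fun t => c t • q) Z (Ioo (-ε) ε) := by
      intro s hs
      refine HasMFDerivAt.hasMFDerivWithinAt ?_
      have h1 := HasMFDerivAt.comp s (hasMFDerivAt_smul_const (EM := EM) q (c s))
        ((hcε s hs).hasMFDerivAt (isOpen_Ioo.mem_nhds hs))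
      refine h1.congr_mfderiv ?_
      have h2 := mfderiv_smul_const_mulInvariantVectorField (c s) q X (hX q)
      have h3 : ∀ (T : EG →L[ℝ] EM) (w : EG), T w = 0 →
          T ∘L ((1 : ℝ →L[ℝ] ℝ).smulRight w) = (1 : ℝ →L[ℝ] ℝ).smulRight (0 : EM) := by
        intro T w hw
        ext
        simp [hw]
      exact h3 _ _ h2
    exact isMIntegralCurveOn_Ioo_eqOn_of_contMDiff_boundaryless (γ := fun t => c t • q)
      (γ' := fun _ => q) hmem hZ hcq ((isMIntegralCurve_const rfl).isMIntegralCurveOn _)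
      (by simp [h0]) ht
  have hd := hc.hasMFDerivAt
  have hev : c =ᶠ[𝓝 0] fun _ => (1 : G) := by
    filter_upwards [Ioo_mem_nhds hmem.1 hmem.2] with t ht using hconst t ht
  have hd' := (hasMFDerivAt_const (I := 𝓘(ℝ, ℝ)) (I' := 𝓘(ℝ, EG)) (1 : G)
    (0 : ℝ)).congr_of_eventuallyEq hev
  have hX0 : (mulInvariantVectorField X (c 0) : EG) = 0 :=
    ContinuousLinearMap.smulRight_one_injective (E := EG)
      ((hasMFDerivAt_unique hd hd').trans
        (show (0 : ℝ →L[ℝ] EG) = (1 : ℝ →L[ℝ] ℝ).smulRight (0 : EG) by ext; simp))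
  rw [h0] at hX0
  have h1 : (fun x : G => 1 * x) = id := funext one_mul
  rw [mulInvariantVectorField, h1, mfderiv_id] at hX0
  exact hX0

theorem eq_zero_of_mfderiv_smul_eq_zero [CompleteSpace EG] [FaithfulSMul G M] (g : G)
    (X : TangentSpace 𝓘(ℝ, EG) g)
    (hX : ∀ p : M, mfderiv 𝓘(ℝ, EG) 𝓘(ℝ, EM) (fun x : G => x • p) g X = 0) : X = 0 := by
  have hR : ∀ a x : G, HasMFDerivAt 𝓘(ℝ, EG) 𝓘(ℝ, EG) (fun y : G => y * a) x
      (mfderiv 𝓘(ℝ, EG) 𝓘(ℝ, EG) (fun y : G => y * a) x) := fun a x =>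
    ((contMDiff_mul_right (I := 𝓘(ℝ, EG)) (n := ∞)).mdifferentiable (by simp) x).hasMFDerivAt
  obtain ⟨Y, hY⟩ : ∃ Y : EG, Y =
    (mfderiv 𝓘(ℝ, EG) 𝓘(ℝ, EG) (fun y : G => y * g⁻¹) g : EG →L[ℝ] EG) X := ⟨_, rfl⟩
  have hY0 : ∀ k : G, k = g * g⁻¹ → ∀ q : M,
      (mfderiv 𝓘(ℝ, EG) 𝓘(ℝ, EM) (fun x : G => x • q) k : EG →L[ℝ] EM) Y = 0 := by
    rintro _ rfl q
    have h1 := HasMFDerivAt.comp g (hasMFDerivAt_smul_const (EM := EM) q (g * g⁻¹)) (hR g⁻¹ g)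
    have h2 := hasMFDerivAt_smul_const (EG := EG) (EM := EM) (g⁻¹ • q) g
    have key := congrArg (fun L : EG →L[ℝ] EM => L X) (hasMFDerivAt_unique
      (h1.congr_of_eventuallyEq (Eventually.of_forall fun x => (mul_smul x g⁻¹ q).symm)) h2)
    rw [hY]
    exact key.trans (hX _)
  have hYz : Y = 0 := eq_zero_of_mfderiv_smul_one_eq_zero (EM := EM) (M := M) (G := G) Y
    (hY0 1 (mul_inv_cancel g).symm)
  have h3 := HasMFDerivAt.comp g (hR g (g * g⁻¹)) (hR g⁻¹ g)
  have key := congrArg (fun L : EG →L[ℝ] EG => L X) (hasMFDerivAt_unique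
    (h3.congr_of_eventuallyEq (f₁ := id) (Eventually.of_forall fun x => by simp))
    (hasMFDerivAt_id g))
  refine Eq.trans (Eq.symm key) ?_
  refine Eq.trans (congrArg (mfderiv 𝓘(ℝ, EG) 𝓘(ℝ, EG) (fun y : G => y * g) (g * g⁻¹))
    (hY.symm.trans hYz)) ?_
  exact map_zero _

end InfinitesimalFaithfulness

section WeakInvarianceBasic

theorem SmoothFlow.contMDiff_apply {E : Type*} [NormedAddCommGroup E] [NormedSpace ℝ E]
    {H : Type*} [TopologicalSpace H] {I : ModelWithCorners ℝ E H}
    {M : Type*} [TopologicalSpace M] [ChartedSpace H M] (φ : SmoothFlow I M) (t : ℝ) :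
    ContMDiff I I ∞ (φ t) :=
  φ.smooth.comp (contMDiff_const.prodMk contMDiff_id)

theorem isWeaklyInvariantMap_iff {G M : Type*} [Group G] [MulAction G M]
    {f : M → M} {σ : G → G} :
    IsWeaklyInvariantMap f σ ↔ ∀ g p, σ g • f p = f (g • p) := by
  simp only [IsWeaklyInvariantMap, funext_iff, Function.comp_apply, eq_inv_smul_iff]

theorem IsWeaklyInvariantMap.eq_of_surjective {G M : Type*} [Group G] [MulAction G M]
    [FaithfulSMul G M] {f : M → M} (hf : Function.Surjective f)
    {σ τ : G → G} (hσ : IsWeaklyInvariantMap f σ) (hτ : IsWeaklyInvariantMap f τ) : σ = τ := by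
  ext g
  refine FaithfulSMul.eq_of_smul_eq_smul (α := M) fun q => ?_
  obtain ⟨p, rfl⟩ := hf q
  rw [isWeaklyInvariantMap_iff.mp hσ, isWeaklyInvariantMap_iff.mp hτ]

variable {EG : Type*} [NormedAddCommGroup EG] [NormedSpace ℝ EG]
  {EM : Type*} [NormedAddCommGroup EM] [NormedSpace ℝ EM]
  {G : Type*} [TopologicalSpace G] [ChartedSpace EG G] [Group G]
  {M : Type*} [TopologicalSpace M] [ChartedSpace EM M]
  [MulAction G M] [ContMDiffSMul 𝓘(ℝ, EG) 𝓘(ℝ, EM) ∞ G M]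
  {V : (p : M) → TangentSpace 𝓘(ℝ, EM) p} {W : (g : G) → TangentSpace 𝓘(ℝ, EG) g}

theorem IsWeaklyInvariantVectorField.isWeaklyInvariantFlow [T2Space M]
    [IsManifold 𝓘(ℝ, EM) ∞ M] (h : IsWeaklyInvariantVectorField V W)
    (hV : IsSmoothVectorField 𝓘(ℝ, EM) V) {ψ : SmoothFlow 𝓘(ℝ, EM) M} (hψ : ψ.IsFlowOf V)
    {φ : SmoothFlow 𝓘(ℝ, EG) G} (hφ : φ.IsFlowOf W) : IsWeaklyInvariantFlow ψ φ := by
  refine fun t => isWeaklyInvariantMap_iff.mpr fun g p => ?_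
  have := h.smul_flow_eq hV hψ (γ := fun t => φ t g) (a := -(|t| + 1)) (b := |t| + 1)
    ⟨by linarith [abs_nonneg t], by linarith [abs_nonneg t]⟩ ((hφ g).isMIntegralCurveOn _)
    (abs_lt.mp (lt_add_one |t|)) p
  rwa [φ.map_zero] at this

theorem IsWeaklyInvariantFlow.isWeaklyInvariantVectorField {ψ : SmoothFlow 𝓘(ℝ, EM) M}
    {φ : SmoothFlow 𝓘(ℝ, EG) G} (h : IsWeaklyInvariantFlow ψ φ) (hψ : ψ.IsFlowOf V)
    (hφ : φ.IsFlowOf W) : IsWeaklyInvariantVectorField V W := by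
  intro g p
  have hd := (hφ g 0).smul_curve (hψ p 0)
  have hd' := (hψ (g • p) 0).congr_of_eventuallyEq
    (Eventually.of_forall fun t => isWeaklyInvariantMap_iff.mp (h t) g p)
  have key : ∀ g' p' q', g' = φ 0 g → p' = ψ 0 p → q' = ψ 0 (g • p) →
      (mfderiv (𝓘(ℝ, EG).prod 𝓘(ℝ, EM)) 𝓘(ℝ, EM) (fun x : G × M => x.1 • x.2) (g', p') :
        EG × EM →L[ℝ] EM) (W g', V p') = V q' := by
    rintro _ _ _ rfl rfl rfl
    exact ContinuousLinearMap.smulRight_one_injective (E := EM) (hasMFDerivAt_unique hd hd')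
  exact key g p (g • p) (φ.map_zero g).symm (ψ.map_zero p).symm (ψ.map_zero _).symm

theorem contMDiffAt_extChartAt_smul_const [IsManifold 𝓘(ℝ, EM) ∞ M] (g : G) (p : M) :
    ContMDiffAt 𝓘(ℝ, EG) 𝓘(ℝ, EM) ∞ (fun x : G => extChartAt 𝓘(ℝ, EM) (g • p) (x • p)) g :=
  ContMDiffAt.comp (g := extChartAt 𝓘(ℝ, EM) (g • p)) (f := fun x : G => x • p) g
    contMDiffAt_extChartAt (contMDiff_smul_const p g)

end WeakInvarianceBasic

section FlowSmoothness

variable {EG : Type*} [NormedAddCommGroup EG] [NormedSpace ℝ EG] [FiniteDimensional ℝ EG]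
  {EM : Type*} [NormedAddCommGroup EM] [NormedSpace ℝ EM]
  {G : Type*} [TopologicalSpace G] [ChartedSpace EG G] [Group G] [LieGroup 𝓘(ℝ, EG) ∞ G]
  {M : Type*} [TopologicalSpace M] [T2Space M] [ChartedSpace EM M] [IsManifold 𝓘(ℝ, EM) ∞ M]
  [MulAction G M] [ContMDiffSMul 𝓘(ℝ, EG) 𝓘(ℝ, EM) ∞ G M] [FaithfulSMul G M]

/-- Finitely many orbit maps, read in charts, form an immersion. -/
theorem exists_finset_injective_mfderiv_orbit (g : G) :
    ∃ s : Finset M, Function.Injective (mfderiv 𝓘(ℝ, EG) 𝓘(ℝ, s → EM)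
      (fun (x : G) (i : s) => extChartAt 𝓘(ℝ, EM) (g • (i : M)) (x • (i : M))) g) := by
  have : CompleteSpace EG := FiniteDimensional.complete ℝ EG
  obtain ⟨s, hs⟩ := exists_finset_forall_eq_zero_of_forall_eq_zero (E := EG) (F := EM)
    (fun p : M => mfderiv 𝓘(ℝ, EG) 𝓘(ℝ, EM) (fun x : G => x • p) g)
    fun v hv => eq_zero_of_mfderiv_smul_eq_zero (EG := EG) (EM := EM) (M := M) g v hv
  refine ⟨s, ?_⟩
  have hF : ContMDiffAt 𝓘(ℝ, EG) 𝓘(ℝ, s → EM) ∞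
      (fun (x : G) (i : s) => extChartAt 𝓘(ℝ, EM) (g • (i : M)) (x • (i : M))) g :=
    contMDiffAt_pi_space.mpr fun i => contMDiffAt_extChartAt_smul_const g (i : M)
  have hd := (hF.mdifferentiableAt (by simp)).hasMFDerivAt
  set D : EG →L[ℝ] (s → EM) := mfderiv 𝓘(ℝ, EG) 𝓘(ℝ, s → EM)
      (fun (x : G) (i : s) => extChartAt 𝓘(ℝ, EM) (g • (i : M)) (x • (i : M))) g with hD
  change Function.Injective D
  rw [injective_iff_map_eq_zero]
  intro v hv
  refine hs v fun p hp => ?_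
  have h1 := HasMFDerivAt.comp g (ContinuousLinearMap.hasMFDerivAt
    (ContinuousLinearMap.proj (R := ℝ) (φ := fun _ : s => EM) ⟨p, hp⟩)) hd
  have h2 := HasMFDerivAt.comp g (mdifferentiableAt_extChartAt (I := 𝓘(ℝ, EM))
    (mem_chart_source EM (g • p))).hasMFDerivAt (hasMFDerivAt_smul_const (EG := EG) (EM := EM) p g)
  have key := congrArg (fun L : EG →L[ℝ] EM => L v) (hasMFDerivAt_unique h1 h2)
  have hinv := (isInvertible_mfderiv_extChartAt (I := 𝓘(ℝ, EM))
    (mem_extChartAt_source (I := 𝓘(ℝ, EM)) (g • p))).injective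
  refine hinv (Eq.trans (Eq.symm key) (Eq.trans ?_ (Eq.symm (map_zero _))))
  exact congrFun hv ⟨p, hp⟩

theorem contMDiff_of_smul_flow_eq [FiniteDimensional ℝ EM] {ψ : SmoothFlow 𝓘(ℝ, EM) M} {φ : ℝ → G → G}
    (hc : Continuous fun x : ℝ × G => φ x.1 x.2)
    (h : ∀ (t : ℝ) (g : G) (p : M), φ t g • ψ t p = ψ t (g • p)) :
    ContMDiff (𝓘(ℝ, ℝ).prod 𝓘(ℝ, EG)) 𝓘(ℝ, EG) ∞ (fun x : ℝ × G => φ x.1 x.2) := by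
  intro x₀
  obtain ⟨s, hs⟩ := exists_finset_injective_mfderiv_orbit (EG := EG) (EM := EM) (M := M)
    (φ x₀.1 x₀.2)
  refine ContMDiffAt.of_comp_of_injective_mfderiv (F := s → EM) (A := fun (x : G) (i : s) =>
    extChartAt 𝓘(ℝ, EM) (φ x₀.1 x₀.2 • (i : M)) (x • (i : M))) hc.continuousAt
    (contMDiffAt_pi_space.mpr fun i => contMDiffAt_extChartAt_smul_const _ (i : M)) hs
    (contMDiffAt_pi_space.mpr fun i => ?_)
  have hact : ContMDiff (𝓘(ℝ, ℝ).prod 𝓘(ℝ, EG)) 𝓘(ℝ, EM) ∞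
      (fun x : ℝ × G => φ x.1 x.2 • (i : M)) := by
    have h1 : ContMDiff (𝓘(ℝ, ℝ).prod 𝓘(ℝ, EG)) 𝓘(ℝ, EM) ∞
        (fun x : ℝ × G => ψ (-x.1) (i : M)) :=
      ψ.smooth.comp ((contDiff_neg.contMDiff.comp contMDiff_fst).prodMk contMDiff_const)
    have h2 : ContMDiff (𝓘(ℝ, ℝ).prod 𝓘(ℝ, EG)) 𝓘(ℝ, EM) ∞
        (fun x : ℝ × G => ψ x.1 (x.2 • ψ (-x.1) (i : M))) :=
      ψ.smooth.comp (contMDiff_fst.prodMk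
        (ContMDiff.smul (I := 𝓘(ℝ, EG)) (contMDiff_snd) h1))
    refine h2.congr fun x => ?_
    rw [← h, ← ψ.map_add, add_neg_cancel, ψ.map_zero]
  exact ContMDiffAt.comp (g := extChartAt 𝓘(ℝ, EM) (φ x₀.1 x₀.2 • (i : M)))
    (f := fun x : ℝ × G => φ x.1 x.2 • (i : M)) x₀ contMDiffAt_extChartAt (hact x₀)

variable [T2Space G] {V : (p : M) → TangentSpace 𝓘(ℝ, EM) p}
  {W : (g : G) → TangentSpace 𝓘(ℝ, EG) g}

theorem IsWeaklyInvariantVectorField.exists_smoothFlow [FiniteDimensional ℝ EM]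
    (h : IsWeaklyInvariantVectorField V W)
    (hV : IsSmoothVectorField 𝓘(ℝ, EM) V) {ψ : SmoothFlow 𝓘(ℝ, EM) M} (hψ : ψ.IsFlowOf V)
    (hW : IsSmoothVectorField 𝓘(ℝ, EG) W) :
    ∃ φ : SmoothFlow 𝓘(ℝ, EG) G, φ.IsFlowOf W := by
  have : CompleteSpace EG := FiniteDimensional.complete ℝ EG
  have hm := h.self_mul hV hψ hW
  choose γ h0 hγ using hm.exists_isMIntegralCurve hW
  have hc := hm.continuous_flow (φ := fun t g => γ g t) hW h0 hγ
  refine ⟨⟨fun t g => γ g t, contMDiff_of_smul_flow_eq (φ := fun t g => γ g t) (ψ := ψ) hc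
    fun t g p => ?_, flow_add_of_isMIntegralCurve (φ := fun t g => γ g t) hW h0 hγ, h0⟩, hγ⟩
  have := h.smul_flow_eq hV hψ (γ := γ g) (a := -(|t| + 1)) (b := |t| + 1)
    ⟨by linarith [abs_nonneg t], by linarith [abs_nonneg t]⟩ ((hγ g).isMIntegralCurveOn _)
    (abs_lt.mp (lt_add_one |t|)) p
  rwa [h0] at this

end FlowSmoothness

theorem mainTheorem4
    {EG : Type*} [NormedAddCommGroup EG] [NormedSpace ℝ EG] [FiniteDimensional ℝ EG]
    {EM : Type*} [NormedAddCommGroup EM] [NormedSpace ℝ EM] [FiniteDimensional ℝ EM]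
    {G : Type*} [TopologicalSpace G] [T2Space G] [ChartedSpace EG G] [Group G]
    [LieGroup 𝓘(ℝ, EG) ∞ G]
    {M : Type*} [TopologicalSpace M] [T2Space M] [ChartedSpace EM M] [IsManifold 𝓘(ℝ, EM) ∞ M]
    [MulAction G M] [ContMDiffSMul 𝓘(ℝ, EG) 𝓘(ℝ, EM) ∞ G M] [FaithfulSMul G M]
    (V : (p : M) → TangentSpace 𝓘(ℝ, EM) p) (hV : IsSmoothVectorField 𝓘(ℝ, EM) V)
    (ψV : SmoothFlow 𝓘(ℝ, EM) M) (hψV : ψV.IsFlowOf V)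
    (W : (g : G) → TangentSpace 𝓘(ℝ, EG) g) (hW : IsSmoothVectorField 𝓘(ℝ, EG) W) :
    (IsWeaklyInvariantVectorField V W ↔
      ∃ ψW : SmoothFlow 𝓘(ℝ, EG) G, ψW.IsFlowOf W ∧ IsWeaklyInvariantFlow ψV ψW) ∧
    (IsWeaklyInvariantVectorField V W →
      ∀ ψW : SmoothFlow 𝓘(ℝ, EG) G, ψW.IsFlowOf W → ∀ t : ℝ,
        IsLieGroupAutomorphism 𝓘(ℝ, EG) (ψW t) ∧
        ∀ σ : G → G, IsWeaklyInvariantMap (ψV t) σ ↔ σ = ψW t) := by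
  have : CompleteSpace EG := FiniteDimensional.complete ℝ EG
  refine ⟨⟨fun h => ?_, fun ⟨ψW, hψW, hinv⟩ => hinv.isWeaklyInvariantVectorField hψV hψW⟩,
    fun h ψW hψW t => ⟨⟨?_, ⟨⟨⟨ψW t, ψW (-t), fun g => ?_, fun g => ?_⟩,
      ψW.contMDiff_apply t, ψW.contMDiff_apply (-t)⟩, rfl⟩⟩, fun σ => ⟨fun hσ => ?_, ?_⟩⟩⟩
  · obtain ⟨ψW, hψW⟩ := h.exists_smoothFlow hV hψV hW
    exact ⟨ψW, hψW, h.isWeaklyInvariantFlow hV hψV hψW⟩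
  · exact (h.self_mul hV hψV hW).flow_mul hW ψW.map_zero hψW t
  · rw [← ψW.map_add, neg_add_cancel, ψW.map_zero]
  · rw [← ψW.map_add, add_neg_cancel, ψW.map_zero]
  · exact hσ.eq_of_surjective
      (fun q => ⟨ψV (-t) q, by rw [← ψV.map_add, add_neg_cancel, ψV.map_zero]⟩)
      (h.isWeaklyInvariantFlow hV hψV hψW t)
  · rintro rfl
    exact h.isWeaklyInvariantFlow hV hψV hψW t
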